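/- Conventions. A torsion-free abelian group $A$ is *separable* if every finite subset of $A$ is contained in a free direct summand of $A$; it is *torsionless* if for every $0\neq a\in A$ there is $f\in\mathrm{Hom}(A,\mathbb{Z})$ with $f(a)\neq 0$; it is *$\aleph_1$-free* if every countable subgroup of $A$ is free abelian; it is *completely decomposable* if it is a direct sum of torsion-free abelian groups of rank $1$. An abelian topological group is *non-Archimedean Polish* if its topology is Polish and $0$ has a countable neighbourhood basis consisting of open subgroups. A *product group* is a topological group of the form $\prod_{n<\omega}H_n$ with each $H_n$ countable and discrete, with the product topology. **Theorem.** There is a family $(G_i)_{i\in I}$ of abelian non-Archimedean Polish groups, with $|I|=2^{\aleph_0}$, such that: 1. each $G_i$ is separable, torsionless and $\aleph_1$-free; 2. no $G_i$ is topologically isomorphic to a product group; 3. for all $i\neq j$ in $I$ there is no surjective continuous homomorphism from $G_i$ onto $G_j$; 4. each $G_i$ is topologically isomorphic to the inverse limit $\varprojlim A_n$ (with the topology induced by the product topology) of an inverse system $(A_n, f_{(n,m)} : m\leq n<\omega)$ with surjective bonding maps, in which each $A_n$ is a countable discrete completely decomposable torsion-free abelian group. -/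

import Mathlib

open Topology Cardinal

/-- An abelian topological group is non-Archimedean Polish if its topology is Polish and the
identity has a countable neighbourhood basis consisting of open subgroups. -/
structure IsNonArchimedeanPolish (G : Type) [AddCommGroup G] [TopologicalSpace G] : Prop where
  isTopologicalAddGroup : IsTopologicalAddGroup G
  polishSpace : PolishSpace G
  basis : ∃ V : ℕ → OpenAddSubgroup G,
    (𝓝 (0 : G)).HasBasis (fun _ : ℕ => True) (fun n => (V n : Set G))

/-- A torsion-free abelian group is separable (in the sense of abelian group theory, not of
topology) if every finite subset is contained in a free direct summand. -/
def IsSeparableAbelian (A : Type) [AddCommGroup A] : Prop :=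
  IsAddTorsionFree A ∧
    ∀ X : Set A, X.Finite → ∃ H K : AddSubgroup A, IsCompl H K ∧ Module.Free ℤ H ∧ X ⊆ H

/-- A torsion-free abelian group is torsionless if homomorphisms to `ℤ` separate its nonzero
elements from `0`. -/
def IsTorsionlessAbelian (A : Type) [AddCommGroup A] : Prop :=
  IsAddTorsionFree A ∧ ∀ a : A, a ≠ 0 → ∃ f : A →+ ℤ, f a ≠ 0

/-- An abelian group is `ℵ₁`-free if every countable subgroup is free abelian. -/
def IsAlephOneFree (A : Type) [AddCommGroup A] : Prop :=
  ∀ H : AddSubgroup A, Countable H → Module.Free ℤ H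

/-- A product group is a countable product `∏ n, H n` of countable discrete groups with the
product topology; this says that `G` is topologically isomorphic to one. (Some or almost all of the
`H n` may be trivial.) -/
def IsProductGroup (G : Type) [AddCommGroup G] [TopologicalSpace G] : Prop :=
  ∃ (H : ℕ → Type) (_ : ∀ n, AddGroup (H n)) (_ : ∀ n, TopologicalSpace (H n))
    (_ : ∀ n, DiscreteTopology (H n)) (_ : ∀ n, Countable (H n)),
    Nonempty (G ≃ₜ+ (∀ n, H n))

/-- A torsion-free abelian group is completely decomposable if it is a direct sum of torsion-free
abelian groups of rank one. -/
def IsCompletelyDecomposable (A : Type) [AddCommGroup A] : Prop :=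
  ∃ (κ : Type) (B : κ → Type) (_ : ∀ k, AddCommGroup (B k)),
    (∀ k, IsAddTorsionFree (B k) ∧ Module.rank ℤ (B k) = 1) ∧
      Nonempty (A ≃+ DirectSum κ B)

/-- An inverse system of abelian groups indexed by the natural numbers, with surjective bonding
maps. -/
structure InverseSequence (A : ℕ → Type) [∀ n, AddCommGroup (A n)] where
  map : ∀ m n : ℕ, m ≤ n → (A n →+ A m)
  map_self : ∀ (n : ℕ) (x : A n), map n n le_rfl x = x
  map_map : ∀ (l m n : ℕ) (hlm : l ≤ m) (hmn : m ≤ n) (x : A n),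
    map l m hlm (map m n hmn x) = map l n (hlm.trans hmn) x
  surjective : ∀ (m n : ℕ) (h : m ≤ n), Function.Surjective (map m n h)

/-- The inverse limit, as the subgroup of coherent sequences in the product. -/
def InverseSequence.limit {A : ℕ → Type} [∀ n, AddCommGroup (A n)] (S : InverseSequence A) :
    AddSubgroup (∀ n, A n) where
  carrier := {a | ∀ (m n : ℕ) (h : m ≤ n), S.map m n h (a n) = a m}
  zero_mem' := fun m n h => map_zero (S.map m n h)
  add_mem' := fun {a b} ha hb m n h => by
    simp only [Pi.add_apply, map_add, ha m n h, hb m n h]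
  neg_mem' := fun {a} ha m n h => by
    simp only [Pi.neg_apply, map_neg, ha m n h]

/-- `G` is topologically isomorphic to the inverse limit of a sequence of countable discrete
completely decomposable torsion-free abelian groups, where the limit carries the topology induced
by the product topology. -/
def IsInverseLimitOfCompletelyDecomposable (G : Type) [AddCommGroup G] [TopologicalSpace G] :
    Prop :=
  ∃ (A : ℕ → Type) (_ : ∀ n, AddCommGroup (A n)) (_ : ∀ n, TopologicalSpace (A n))
    (_ : ∀ n, DiscreteTopology (A n)) (_ : ∀ n, Countable (A n)) (S : InverseSequence A),
    (∀ n, IsAddTorsionFree (A n) ∧ IsCompletelyDecomposable (A n)) ∧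
      Nonempty (G ≃ₜ+ S.limit)

/-! For a set `S` of primes let `R` be the ring of rationals integral at every prime of `S`, and `q
n` the product of the primes of `S` up to `n`. The group attached to `S` consists of the sequences
in `R` with `r n - q n * r (n + 1)` an integer; these integers are its digits. When `S` contains a
prime, the digits embed the group as a pure subgroup of a power of `ℤ`
(`exists_eq_smul_of_dvd_digit`, `eq_zero_of_digit_eq_zero`). Purity alone yields the three algebraic
properties: any element lies in a rank one summand, and such summands can be accumulated along a
sequence of elements (`exists_projections`).

The terms of degree at most `n` form a group isomorphic to `ℤ ^ n × R`, which gives the inverse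
limit. The factor `R` is divisible by each prime `l` outside `S`, although the whole group has no
nonzero infinitely `l`-divisible element. So a homomorphism with open kernel sends the elements
whose first digits vanish to infinitely `l`-divisible elements (`IsLiftable.exists_eq_pow_smul`).
This rules out a product group, whose finite partial products are both discrete quotients and
subgroups. It also rules out surjections from the group of `S` to that of `T` when `T` is not
contained in `S` and omits some prime. An antichain of continuum many sets of primes then gives the
family. -/

/-! ### Pure subgroups of powers of the integers -/

/-- Homomorphisms to `ℤ` separate points and detect divisibility. -/
structure DetectedByIntHoms (A : Type*) [AddCommGroup A] : Prop where
  eq_zero : ∀ a : A, (∀ f : A →+ ℤ, f a = 0) → a = 0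
  divisible : ∀ (m : ℤ) (a : A), m ≠ 0 → (∀ f : A →+ ℤ, m ∣ f a) → ∃ b, a = m • b

/-- An abelian group with a pointwise eventually vanishing, jointly injective sequence of
homomorphisms to `ℤ` is free. -/
theorem free_of_eventually_zero_homs {H : Type*} [AddCommGroup H] (t : ℕ → H →+ ℤ)
    (hfin : ∀ h, ∃ N, ∀ n ≥ N, t n h = 0) (hinj : ∀ h, (∀ n, t n h = 0) → h = 0) :
    Module.Free ℤ H := by
  classical
  -- Echelon form: among the elements whose last possibly nonzero coordinate is the `n`-th, `b` has
  -- a coordinate generating the ideal of all such leading coefficients.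
  have key : ∀ n, ∃ b : H, (∀ i > n, t i b = 0) ∧
      ∀ h, (∀ i > n, t i h = 0) → t n b ∣ t n h := by
    intro n
    let K : AddSubgroup H :=
      { carrier := {h | ∀ i > n, t i h = 0}
        zero_mem' := fun i _ => map_zero _
        add_mem' := fun {a b} ha hb i hi => by simp [ha i hi, hb i hi]
        neg_mem' := fun {a} ha i hi => by simp [ha i hi] }
    obtain ⟨d, hd⟩ := Int.subgroup_cyclic (K.map (t n))
    have hdm : d ∈ K.map (t n) := hd ▸ AddSubgroup.subset_closure rfl
    obtain ⟨b, hb, rfl⟩ := hdm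
    refine ⟨b, hb, fun h hh => ?_⟩
    have : t n h ∈ K.map (t n) := ⟨h, hh, rfl⟩
    rw [hd, AddSubgroup.mem_closure_singleton] at this
    obtain ⟨k, hk⟩ := this
    exact ⟨k, by rw [← hk, smul_eq_mul, mul_comm]⟩
  choose b hb hdvd using key
  -- Degrees whose ideal of leading coefficients is zero contribute no basis vector.
  let ι := {n : ℕ // t n (b n) ≠ 0}
  let v : ι → H := fun i => b i
  have hli : LinearIndependent ℤ v := by
    rw [linearIndependent_iff]
    intro l hl
    by_contra hne
    have hs : l.support.Nonempty := Finsupp.support_nonempty_iff.mpr hne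
    obtain ⟨m, hm, hmax⟩ := l.support.exists_max_image (fun i : ι => (i : ℕ)) hs
    have h1 : t m (Finsupp.linearCombination ℤ v l) = l m * t m (b m) := by
      rw [Finsupp.linearCombination_apply, Finsupp.sum, map_sum, Finset.sum_eq_single m]
      · simp [v]
      · intro i hi him
        have hlt : (i : ℕ) < m := lt_of_le_of_ne (hmax i hi) (fun h => him (Subtype.ext h))
        simp [v, hb i m hlt]
      · intro h; exact absurd hm h
    rw [hl, map_zero] at h1
    rcases mul_eq_zero.mp h1.symm with h | h
    · exact (Finsupp.mem_support_iff.mp hm) h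
    · exact m.2 h
  have hspan : ∀ N h, (∀ i ≥ N, t i h = 0) → h ∈ Submodule.span ℤ (Set.range v) := by
    intro N
    induction N with
    | zero =>
      intro h hh
      rw [hinj h fun n => hh n (Nat.zero_le n)]
      exact zero_mem _
    | succ N ih =>
      intro h hh
      obtain ⟨k, hk⟩ := hdvd N h fun i hi => hh i hi
      have h1 : h - k • b N ∈ Submodule.span ℤ (Set.range v) := by
        refine ih _ fun i hi => ?_
        rcases hi.eq_or_lt with rfl | hlt
        · simp [hk, mul_comm]
        · simp [hh i hlt, hb N i hlt]
      by_cases h0 : t N (b N) = 0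
      · refine ih h fun i hi => ?_
        rcases hi.eq_or_lt with rfl | hlt
        · simp [hk, h0]
        · exact hh i hlt
      · have h2 : b N ∈ Submodule.span ℤ (Set.range v) := Submodule.subset_span ⟨⟨N, h0⟩, rfl⟩
        have := add_mem h1 (Submodule.smul_mem _ k h2)
        simpa using this
  exact Module.Free.of_basis (Module.Basis.mk hli fun h _ => by
    obtain ⟨N, hN⟩ := hfin h
    exact hspan N h hN)

namespace DetectedByIntHoms

variable {A : Type} [AddCommGroup A]

theorem isAddTorsionFree (hA : DetectedByIntHoms A) : IsAddTorsionFree A where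
  nsmul_right_injective n hn a b hab := by
    rw [← sub_eq_zero]
    refine hA.eq_zero _ fun f => ?_
    have h : n • (a - b) = 0 := by rw [nsmul_sub]; exact sub_eq_zero.mpr hab
    have h' := congrArg f h
    rw [map_nsmul, map_zero, nsmul_eq_mul] at h'
    exact (mul_eq_zero.mp h').resolve_left (by exact_mod_cast hn)

theorem isTorsionlessAbelian (hA : DetectedByIntHoms A) : IsTorsionlessAbelian A :=
  ⟨hA.isAddTorsionFree, fun a ha => by
    by_contra! h
    exact ha (hA.eq_zero a h)⟩

/-- The values at `x` of all homomorphisms form an ideal, whose generator `d` is attained by some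
`f`. Purity gives `x = d • y`, and cancelling `d` in `f x = d` leaves `f y = 1`. -/
theorem exists_hom_eq_one (hA : DetectedByIntHoms A) {x : A} (hx : x ≠ 0) :
    ∃ (f : A →+ ℤ) (y : A), f y = 1 ∧ x = f x • y := by
  let ev : (A →+ ℤ) →+ ℤ := AddMonoidHom.eval x
  obtain ⟨d, hd⟩ := Int.subgroup_cyclic ev.range
  obtain ⟨f, hf⟩ : d ∈ ev.range := hd ▸ AddSubgroup.subset_closure rfl
  have hf : f x = d := hf
  have hdvd : ∀ g : A →+ ℤ, d ∣ g x := by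
    intro g
    have : g x ∈ ev.range := ⟨g, rfl⟩
    rw [hd, AddSubgroup.mem_closure_singleton] at this
    obtain ⟨k, hk⟩ := this
    exact ⟨k, by rw [← hk, smul_eq_mul, mul_comm]⟩
  have hd0 : d ≠ 0 := by
    rintro rfl
    exact hx (hA.eq_zero x fun g => zero_dvd_iff.mp (hdvd g))
  obtain ⟨y, hy⟩ := hA.divisible d x hd0 hdvd
  refine ⟨f, y, ?_, by rw [hf]; exact hy⟩
  have h := congrArg f hy
  rw [hf, map_zsmul, smul_eq_mul] at h
  exact (mul_right_eq_self₀.mp h.symm).resolve_right hd0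

/-- An idempotent endomorphism can be enlarged by a rank one piece so as to fix a given element. -/
theorem exists_rank_one_extension (hA : DetectedByIntHoms A) (π : A →+ A)
    (hπ : ∀ a, π (π a) = π a) (x : A) :
    ∃ (t : A →+ ℤ) (y : A), (∀ a, t (π a) = 0) ∧ π y = 0 ∧ t y • y = y ∧ π x + t x • y = x := by
  by_cases hx : x - π x = 0
  -- If `x` is already fixed, nothing is added; to allow `y = 0` the conclusion asks for `t y • y =
  -- y` rather than `t y = 1`.
  · exact ⟨0, 0, by simp, by simp, by simp, by simpa using (sub_eq_zero.mp hx).symm⟩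
  obtain ⟨f, y, hy, hfx⟩ := hA.exists_hom_eq_one hx
  have h0 : f (x - π x) ≠ 0 := fun h => hx (by rw [hfx, h, zero_smul])
  have hπy : π y = 0 := by
    have h1 : π (x - π x) = 0 := by rw [map_sub, hπ, sub_self]
    rw [hfx, map_zsmul] at h1
    have := hA.isAddTorsionFree
    exact (smul_eq_zero.mp h1).resolve_left h0
  refine ⟨f - f.comp π, y, fun a => by simp [hπ], hπy, by simp [hπy, hy], ?_⟩
  have : (f - f.comp π) x = f (x - π x) := by simp
  rw [this, ← hfx]
  abel

/-- An increasing sequence of idempotents of countable range, the `n`-th step fixing `h n`. -/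
theorem exists_projections (hA : DetectedByIntHoms A) (h : ℕ → A) :
    ∃ (π : ℕ → A →+ A) (t : ℕ → A →+ ℤ) (y : ℕ → A),
      (∀ a, π 0 a = 0) ∧ (∀ n a, π n (π n a) = π n a) ∧
      (∀ n a, π (n + 1) a = π n a + t n a • y n) ∧ (∀ n a, t n (π n a) = 0) ∧
      (∀ n m, n < m → π m (h n) = h n) := by
  let P := {π : A →+ A // ∀ a, π (π a) = π a}
  have step : ∀ (n : ℕ) (π : P), ∃ (t : A →+ ℤ) (y : A) (π' : P),
      (∀ a, π'.1 a = π.1 a + t a • y) ∧ (∀ a, t (π.1 a) = 0) ∧ π'.1 (h n) = h n := by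
    intro n π
    obtain ⟨t, y, h1, h2, h3, h4⟩ := hA.exists_rank_one_extension π.1 π.2 (h n)
    refine ⟨t, y, ⟨π.1 + (zmultiplesHom A y).comp t, fun a => ?_⟩, fun a => ?_, h1, ?_⟩
    · simp [π.2, h1, h2, mul_smul, h3]
    · simp
    · simpa using h4
  choose t y next h1 h2 h3 using step
  let π : ℕ → P := fun n => Nat.rec ⟨0, by simp⟩ next n
  -- Fixed elements stay fixed because the new functional vanishes on the old range.
  have hfix : ∀ n a, (π n).1 a = a → (π (n + 1)).1 a = a := by
    intro n a ha
    have e := h1 n (π n) a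
    have e2 := h2 n (π n) a
    rw [ha] at e e2
    rw [e2, zero_smul, add_zero] at e
    exact e
  refine ⟨fun n => (π n).1, fun n => t n (π n), fun n => y n (π n), fun a => rfl,
    fun n => (π n).2, fun n a => h1 n (π n) a, fun n a => h2 n (π n) a, fun n m hnm => ?_⟩
  induction m, hnm using Nat.le_induction with
  | base => exact h3 n (π n)
  | succ m _ ih => exact hfix m _ ih

/-- Take the projections along an enumeration of `H` and use their increments `t n` as coordinates.
They vanish on the `k`-th element after stage `k`, where it is already fixed; if all of them vanish
on it, every projection kills it, including one that fixes it. -/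
theorem isAlephOneFree (hA : DetectedByIntHoms A) : IsAlephOneFree A := by
  intro H hH
  obtain ⟨e, he⟩ := exists_surjective_nat H
  obtain ⟨π, t, y, h0, hid, hsucc, ht, hfix⟩ := hA.exists_projections fun n => (e n : A)
  refine free_of_eventually_zero_homs (fun n => (t n).comp H.subtype) (fun x => ?_) fun x hx => ?_
  · obtain ⟨k, rfl⟩ := he x
    refine ⟨k + 1, fun n hn => ?_⟩
    have := ht n (e k)
    rw [hfix k n hn] at this
    exact this
  · obtain ⟨k, rfl⟩ := he x
    have hz : ∀ n, π n (e k) = 0 := by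
      intro n
      induction n with
      | zero => exact h0 _
      | succ n ih =>
        have hn : t n (e k) = 0 := hx n
        rw [hsucc, ih, hn, zero_smul, add_zero]
    have := hfix k (k + 1) (Nat.lt_succ_self k)
    rw [hz] at this
    exact Subtype.ext this.symm

/-- The summand is the range of a projection fixing the finite set, with the kernel as complement.
That range is countable, hence free by `ℵ₁`-freeness. -/
theorem isSeparableAbelian (hA : DetectedByIntHoms A) : IsSeparableAbelian A := by
  refine ⟨hA.isAddTorsionFree, fun X hX => ?_⟩
  obtain ⟨h, N, hN⟩ : ∃ (h : ℕ → A) (N : ℕ), ∀ x ∈ X, ∃ n < N, h n = x := by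
    refine ⟨fun n => hX.toFinset.toList.getD n 0, hX.toFinset.toList.length, fun x hx => ?_⟩
    obtain ⟨n, hn, hnx⟩ := List.mem_iff_getElem.mp (Finset.mem_toList.mpr (hX.mem_toFinset.mpr hx))
    exact ⟨n, hn, (List.getD_eq_getElem _ _ hn).trans hnx⟩
  obtain ⟨π, t, y, h0, hid, hsucc, ht, hfix⟩ := hA.exists_projections h
  have hcount : ∀ n, Countable (π n).range := by
    intro n
    induction n with
    | zero =>
      have : (π 0).range = ⊥ := by
        rw [AddMonoidHom.range_eq_bot_iff]; ext a; exact h0 a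
      rw [this]; infer_instance
    | succ n ih =>
      have hsub : ((π (n + 1)).range : Set A) ⊆
          Set.range fun p : (π n).range × ℤ => (p.1 : A) + p.2 • y n := by
        rintro _ ⟨a, rfl⟩
        exact ⟨(⟨π n a, a, rfl⟩, t n a), (hsucc n a).symm⟩
      exact ((Set.countable_range _).mono hsub).to_subtype
  refine ⟨(π N).range, (π N).ker, ?_, hA.isAlephOneFree _ (hcount N), fun x hx => ?_⟩
  · refine IsCompl.of_eq ?_ ?_
    · rw [eq_bot_iff]
      rintro _ ⟨⟨a, rfl⟩, hk⟩
      exact (hid N a).symm.trans hk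
    · rw [eq_top_iff]
      intro a _
      have h1 : a - π N a ∈ (π N).ker := by
        rw [AddMonoidHom.mem_ker, map_sub, hid, sub_self]
      have := AddSubgroup.add_mem_sup (show π N a ∈ (π N).range from ⟨a, rfl⟩) h1
      simpa using this
  · obtain ⟨n, hn, rfl⟩ := hN x hx
    exact ⟨h n, hfix n N hn⟩

end DetectedByIntHoms

/-! ### Rationals integral at a set of primes -/

/-- The rational numbers with the discrete topology. -/
def DiscreteRat : Type := ℚ

namespace DiscreteRat

instance : Field DiscreteRat := inferInstanceAs (Field ℚ)
instance : CharZero DiscreteRat := inferInstanceAs (CharZero ℚ)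
instance : Countable DiscreteRat := inferInstanceAs (Countable ℚ)
instance : TopologicalSpace DiscreteRat := ⊥
instance : DiscreteTopology DiscreteRat := ⟨rfl⟩

theorem exists_coprime_fraction (x : DiscreteRat) :
    ∃ a b : ℤ, b ≠ 0 ∧ IsCoprime a b ∧ b * x = a := by
  let y : ℚ := x
  refine ⟨y.num, y.den, by exact_mod_cast y.den_nz, ?_, ?_⟩
  · exact Int.isCoprime_iff_gcd_eq_one.mpr y.reduced
  · have : ((y.den : ℤ) : ℚ) * y = (y.num : ℚ) := by
      rw [mul_comm]; exact_mod_cast Rat.mul_den_eq_num y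
    exact this

/-- The rational numbers integral at every prime in `S`. -/
def integralAt (S : Set ℕ) : AddSubgroup DiscreteRat where
  carrier := {x | ∀ p ∈ S, p.Prime → ∃ d a : ℤ, ¬ (p : ℤ) ∣ d ∧ d * x = a}
  zero_mem' := fun p _ hp => ⟨1, 0, by
    intro h
    exact hp.one_lt.ne' (by exact_mod_cast Int.eq_one_of_dvd_one (by positivity) h), by simp⟩
  add_mem' := by
    intro x y hx hy p hpS hp
    obtain ⟨d, a, hd, ha⟩ := hx p hpS hp
    obtain ⟨e, b, he, hb⟩ := hy p hpS hp
    refine ⟨d * e, e * a + d * b, fun h => ?_, ?_⟩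
    · exact ((Nat.prime_iff_prime_int.mp hp).dvd_or_dvd h).elim hd he
    · push_cast
      linear_combination (e : DiscreteRat) * ha + (d : DiscreteRat) * hb
  neg_mem' := by
    intro x hx p hpS hp
    obtain ⟨d, a, hd, ha⟩ := hx p hpS hp
    exact ⟨d, -a, hd, by push_cast; linear_combination -ha⟩

variable {S : Set ℕ}

theorem intCast_mem_integralAt (S : Set ℕ) (n : ℤ) : (n : DiscreteRat) ∈ integralAt S := by
  intro p _ hp
  refine ⟨1, n, fun h => ?_, by simp⟩
  exact hp.one_lt.ne' (by exact_mod_cast Int.eq_one_of_dvd_one (by positivity) h)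

theorem div_pow_mem_integralAt {x : DiscreteRat} (hx : x ∈ integralAt S) {l : ℕ} (hl : l.Prime)
    (hlS : l ∉ S) (k : ℕ) : x / l ^ k ∈ integralAt S := by
  intro p hpS hp
  obtain ⟨d, a, hd, ha⟩ := hx p hpS hp
  have hlp : p ≠ l := by rintro rfl; exact hlS hpS
  have hpp := Nat.prime_iff_prime_int.mp hp
  refine ⟨d * l ^ k, a, fun h => ?_, ?_⟩
  · rcases hpp.dvd_or_dvd h with h | h
    · exact hd h
    · have h2 := hpp.dvd_of_dvd_pow h
      exact hlp ((Nat.prime_dvd_prime_iff_eq hp hl).mp (by exact_mod_cast h2))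
  · have : (l : DiscreteRat) ≠ 0 := by exact_mod_cast hl.ne_zero
    push_cast
    field_simp
    exact ha

/-- Denominators in `integralAt S` are prime to `p`, so every power of `p` divides the numerator of
`x`. -/
theorem eq_zero_of_forall_pow_mul {x : DiscreteRat} {p : ℕ} (hpS : p ∈ S) (hp : p.Prime)
    (h : ∀ k : ℕ, ∃ y ∈ integralAt S, x = (p : DiscreteRat) ^ k * y) : x = 0 := by
  obtain ⟨a, b, hb, -, hab⟩ := exists_coprime_fraction x
  have hdvd : ∀ k : ℕ, (p : ℤ) ^ k ∣ a := by
    intro k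
    obtain ⟨y, hy, hxy⟩ := h k
    obtain ⟨d, c, hd, hc⟩ := hy p hpS hp
    have hcop : IsCoprime ((p : ℤ) ^ k) d :=
      ((Nat.prime_iff_prime_int.mp hp).coprime_iff_not_dvd.mpr hd).pow_left
    refine hcop.dvd_of_dvd_mul_left ⟨b * c, ?_⟩
    have : ((d * a : ℤ) : DiscreteRat) = ((p ^ k * (b * c) : ℤ) : DiscreteRat) := by
      push_cast
      rw [← hab, ← hc, hxy]
      ring
    exact_mod_cast this
  have ha : a = 0 := by
    by_contra ha
    have h1 := Nat.le_of_dvd (Int.natAbs_pos.mpr ha) (Int.natAbs_dvd_natAbs.mpr (hdvd a.natAbs))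
    rw [Int.natAbs_pow, Int.natAbs_natCast] at h1
    exact absurd (Nat.lt_pow_self hp.one_lt) (not_lt.mpr h1)
  rw [ha, Int.cast_zero] at hab
  exact (mul_eq_zero.mp hab).resolve_left (by exact_mod_cast hb)

/-- The reduced denominator `b` of `x = a / b` is coprime to `q`. From `u * b + v * q = 1` follows
`a / b = u * a + q * (v * a / b)`. -/
theorem exists_eq_intCast_add_mul {x : DiscreteRat} (hx : x ∈ integralAt S) {q : ℕ}
    (hqS : ∀ p : ℕ, p.Prime → p ∣ q → p ∈ S) :
    ∃ y ∈ integralAt S, ∃ c : ℤ, x = c + q * y := by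
  obtain ⟨a, b, hb, hab, hx'⟩ := exists_coprime_fraction x
  have hbS : ∀ p ∈ S, p.Prime → ¬ (p : ℤ) ∣ b := by
    intro p hpS hp h
    obtain ⟨d, c, hd, hc⟩ := hx p hpS hp
    have h1 : d * a = c * b := by
      have : ((d * a : ℤ) : DiscreteRat) = ((c * b : ℤ) : DiscreteRat) := by
        push_cast
        rw [← hx', ← hc]
        ring
      exact_mod_cast this
    have h2 : b ∣ d := hab.symm.dvd_of_dvd_mul_right ⟨c, by rw [h1, mul_comm]⟩
    exact hd (h.trans h2)
  have hcop : IsCoprime b (q : ℤ) := by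
    rw [Int.isCoprime_iff_gcd_eq_one]
    by_contra hne
    obtain ⟨p, hp, hpd⟩ := Nat.exists_prime_and_dvd hne
    have h1 : (p : ℤ) ∣ b := (Int.natCast_dvd_natCast.mpr hpd).trans (Int.gcd_dvd_left ..)
    have h2 : (p : ℤ) ∣ q := (Int.natCast_dvd_natCast.mpr hpd).trans (Int.gcd_dvd_right ..)
    exact hbS p (hqS p hp (by exact_mod_cast h2)) hp h1
  obtain ⟨u, v, huv⟩ := hcop
  have hb0 : (b : DiscreteRat) ≠ 0 := by exact_mod_cast hb
  have huv' : (u : DiscreteRat) * b + v * q = 1 := by exact_mod_cast huv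
  refine ⟨v * a / b, fun p hpS hp => ⟨b, v * a, hbS p hpS hp, ?_⟩, u * a, ?_⟩
  · push_cast
    field_simp
  · push_cast
    field_simp
    linear_combination hx' - (a : DiscreteRat) * huv'

/-! ### Towers and their digits -/

/-- Sequences in `R` whose consecutive terms satisfy `r n ≡ q n * r (n + 1)` modulo `ℤ`. -/
def tower (R : AddSubgroup DiscreteRat) (q : ℕ → ℕ) : AddSubgroup (ℕ → DiscreteRat) where
  carrier := {r | ∀ n, r n ∈ R ∧ ∃ c : ℤ, r n = c + q n * r (n + 1)}
  zero_mem' := fun n => ⟨zero_mem R, 0, by simp⟩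
  add_mem' := by
    intro r s hr hs n
    obtain ⟨hr, c, hc⟩ := hr n
    obtain ⟨hs, d, hd⟩ := hs n
    exact ⟨add_mem hr hs, c + d, by simp only [Pi.add_apply]; rw [hc, hd]; push_cast; ring⟩
  neg_mem' := by
    intro r hr n
    obtain ⟨hr, c, hc⟩ := hr n
    exact ⟨neg_mem hr, -c, by simp only [Pi.neg_apply]; rw [hc]; push_cast; ring⟩

variable {R : AddSubgroup DiscreteRat} {q : ℕ → ℕ}

theorem natCast_mul_mem {x : DiscreteRat} (hx : x ∈ R) (n : ℕ) : (n : DiscreteRat) * x ∈ R := by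
  rw [← nsmul_eq_mul]
  exact nsmul_mem hx n

/-- The integers `r n - q n * r (n + 1)` attached to an element of a tower. -/
noncomputable def digit (R : AddSubgroup DiscreteRat) (q : ℕ → ℕ) (n : ℕ) : tower R q →+ ℤ :=
  AddMonoidHom.mk' (fun r => (r.2 n).2.choose) (by
    intro r s
    have h1 := (r.2 n).2.choose_spec
    have h2 := (s.2 n).2.choose_spec
    have h3 := ((r + s).2 n).2.choose_spec
    have h4 : (((r + s).2 n).2.choose : DiscreteRat) =
        ((r.2 n).2.choose + (s.2 n).2.choose : ℤ) := by
      push_cast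
      have e1 : (r + s : tower R q).1 n = r.1 n + s.1 n := rfl
      have e2 : (r + s : tower R q).1 (n + 1) = r.1 (n + 1) + s.1 (n + 1) := rfl
      linear_combination h1 + h2 - h3 + e1 - (q n : DiscreteRat) * e2
    exact_mod_cast h4)

theorem apply_eq_digit_add (r : tower R q) (n : ℕ) :
    r.1 n = digit R q n r + q n * r.1 (n + 1) :=
  (r.2 n).2.choose_spec

theorem digit_eq_of_apply_eq {r : tower R q} {n : ℕ} {c : ℤ}
    (h : r.1 n = c + q n * r.1 (n + 1)) : digit R q n r = c := by
  have : (digit R q n r : DiscreteRat) = c := by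
    linear_combination h - apply_eq_digit_add r n
  exact_mod_cast this

/-- Every element of `R` is congruent to a multiple of `q n` modulo `ℤ`. -/
def IsLiftable (R : AddSubgroup DiscreteRat) (q : ℕ → ℕ) : Prop :=
  ∀ n, ∀ x ∈ R, ∃ y ∈ R, ∃ c : ℤ, x = c + q n * y

theorem IsLiftable.exists_apply_eq (h : IsLiftable R q) (m : ℕ) {x : DiscreteRat} (hx : x ∈ R) :
    ∃ v : ℕ → DiscreteRat, v m = x ∧ ∀ n ≥ m, v n ∈ R ∧ ∃ c : ℤ, v n = c + q n * v (n + 1) := by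
  choose g hgR hg using fun n (x : R) => h n x.1 x.2
  let v : ℕ → R := fun n => Nat.rec ⟨x, hx⟩ (fun k y => ⟨g (m + k) y, hgR (m + k) y⟩) n
  -- Below `m` the truncated subtraction returns the junk value `x`, about which nothing is claimed.
  refine ⟨fun n => (v (n - m)).1, by simp [v], fun n hn => ⟨(v (n - m)).2, ?_⟩⟩
  obtain ⟨k, rfl⟩ := Nat.exists_eq_add_of_le hn
  have h1 : m + k - m = k := by omega
  have h2 : m + k + 1 - m = k + 1 := by omega
  simp only [h1, h2]
  exact hg (m + k) (v k)

/-- A finite tower extends to an infinite one. -/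
theorem IsLiftable.exists_extension (h : IsLiftable R q) (m : ℕ) (a : ℕ → DiscreteRat)
    (haR : ∀ i ≤ m, a i ∈ R) (ha : ∀ i < m, ∃ c : ℤ, a i = c + q i * a (i + 1)) :
    ∃ r : tower R q, ∀ i ≤ m, r.1 i = a i := by
  obtain ⟨v, hvm, hv⟩ := h.exists_apply_eq m (haR m le_rfl)
  refine ⟨⟨fun i => if i ≤ m then a i else v i, fun n => ?_⟩, fun i hi => if_pos hi⟩
  beta_reduce
  rcases lt_trichotomy n m with hn | rfl | hn
  · rw [if_pos hn.le, if_pos (Nat.succ_le_of_lt hn)]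
    exact ⟨haR n hn.le, ha n hn⟩
  · rw [if_pos le_rfl, if_neg (by omega), ← hvm]
    exact hv n le_rfl
  · rw [if_neg (by omega), if_neg (by omega)]
    exact hv n hn.le

/-- Towers with prescribed `m`-th term and vanishing earlier digits. -/
theorem IsLiftable.exists_digit_eq_zero (h : IsLiftable R q) (m : ℕ) {x : DiscreteRat}
    (hx : x ∈ R) :
    ∃ r : tower R q, r.1 m = x ∧ (∀ i ≤ m, r.1 i = (∏ k ∈ Finset.Ico i m, q k : ℕ) * x) ∧
      ∀ i < m, digit R q i r = 0 := by
  -- Going down from degree `m` with all digits zero multiplies `x` by the successive `q i`.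
  have hstep : ∀ i < m, ((∏ k ∈ Finset.Ico i m, q k : ℕ) : DiscreteRat) * x =
      q i * ((∏ k ∈ Finset.Ico (i + 1) m, q k : ℕ) * x) := by
    intro i hi
    rw [Finset.prod_eq_prod_Ico_succ_bot hi]
    push_cast
    ring
  obtain ⟨r, hr⟩ := h.exists_extension m
    (fun i => ((∏ k ∈ Finset.Ico i m, q k : ℕ) : DiscreteRat) * x)
    (fun i _ => natCast_mul_mem hx _) (fun i hi => ⟨0, by simpa using hstep i hi⟩)
  refine ⟨r, by simpa using hr m le_rfl, hr, fun i hi => digit_eq_of_apply_eq ?_⟩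
  rw [hr i hi.le, hr (i + 1) hi, hstep i hi]
  simp

/-- Towers whose digits below `m` form the `j`-th unit vector and whose `m`-th term vanishes. -/
theorem IsLiftable.exists_digit_eq_single (h : IsLiftable R q) (h1 : 1 ∈ R) (m : ℕ) {j : ℕ}
    (hj : j < m) :
    ∃ r : tower R q, ∀ i < m, digit R q i r = if i = j then 1 else 0 := by
  -- The digit `1` enters in degree `j`: the terms above `j` are zero, and those below are the
  -- products of the intervening `q k`.
  let a : ℕ → DiscreteRat := fun i =>
    if i ≤ j then ((∏ k ∈ Finset.Ico i j, q k : ℕ) : DiscreteRat) else 0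
  have hstep : ∀ i, a i = ((if i = j then 1 else 0 : ℤ) : DiscreteRat) + q i * a (i + 1) := by
    intro i
    rcases lt_trichotomy i j with hi | rfl | hi
    · simp only [a]
      rw [if_pos hi.le, if_neg hi.ne, if_pos (Nat.succ_le_of_lt hi),
        Finset.prod_eq_prod_Ico_succ_bot hi]
      push_cast
      ring
    · simp [a]
    · simp only [a]
      rw [if_neg (by omega), if_neg (by omega), if_neg (by omega)]
      simp
  obtain ⟨r, hr⟩ := h.exists_extension m a (fun i _ => by
    simp only [a]
    split_ifs
    · simpa only [mul_one] using natCast_mul_mem h1 (∏ k ∈ Finset.Ico i j, q k)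
    · exact zero_mem R) (fun i _ => ⟨_, hstep i⟩)
  refine ⟨r, fun i hi => digit_eq_of_apply_eq ?_⟩
  rw [hr i hi.le, hr (i + 1) hi]
  exact hstep i

theorem apply_eq_of_digit_eq_zero {r : tower R q} {m : ℕ} (h : ∀ i < m, digit R q i r = 0)
    (hm : r.1 m = 0) : ∀ i ≤ m, r.1 i = 0 := by
  intro i hi
  refine Nat.decreasingInduction' (P := fun i => r.1 i = 0) (fun k hk _ ih => ?_) hi hm
  rw [apply_eq_digit_add, h k hk, ih]
  simp

/-- A homomorphism which only depends on the first terms takes infinitely divisible values on towers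
with vanishing first digits. -/
theorem IsLiftable.exists_eq_pow_smul (h : IsLiftable R q) {l : ℕ} (hl : l ≠ 0)
    (hdiv : ∀ x ∈ R, ∀ k : ℕ, x / (l : DiscreteRat) ^ k ∈ R) {M : Type*} [AddCommGroup M]
    (θ : tower R q →+ M) {m : ℕ} (hθ : ∀ r : tower R q, (∀ i ≤ m, r.1 i = 0) → θ r = 0)
    {u : tower R q} (hu : ∀ i < m, digit R q i u = 0) (k : ℕ) :
    ∃ w : tower R q, θ u = (l ^ k) • θ w := by
  -- The `m`-th term of `w` is that of `u` divided by `l ^ k`. Then `u - l ^ k • w` has vanishing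
  -- `m`-th term and vanishing earlier digits, hence vanishing terms up to `m`.
  obtain ⟨w, hwm, -, hw⟩ := h.exists_digit_eq_zero m (hdiv _ (u.2 m).1 k)
  refine ⟨w, ?_⟩
  rw [← map_nsmul, ← sub_eq_zero, ← map_sub]
  refine hθ _ (apply_eq_of_digit_eq_zero (fun i hi => ?_) ?_)
  · rw [map_sub, map_nsmul, hu i hi, hw i hi, smul_zero, sub_zero]
  · have e : (u - (l ^ k) • w).1 m = u.1 m - (l ^ k) • w.1 m := rfl
    have hl' : (l : DiscreteRat) ≠ 0 := by exact_mod_cast hl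
    rw [e, hwm, nsmul_eq_mul]
    push_cast
    field_simp
    ring

/-! ### Digits detect vanishing and divisibility -/

/-- The product of the primes in `S` up to `n`. -/
noncomputable def primeProd (S : Set ℕ) (n : ℕ) : ℕ := by
  classical exact ∏ p ∈ (Finset.range (n + 1)).filter (fun p => p.Prime ∧ p ∈ S), p

theorem dvd_primeProd {p n : ℕ} (hp : p.Prime) (hpS : p ∈ S) (hn : p ≤ n) :
    p ∣ primeProd S n := by
  classical
  exact Finset.dvd_prod_of_mem (fun p => p)
    (Finset.mem_filter.mpr ⟨Finset.mem_range.mpr (Nat.lt_succ_of_le hn), hp, hpS⟩)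

theorem primeProd_ne_zero (S : Set ℕ) (n : ℕ) : primeProd S n ≠ 0 := by
  classical
  exact Finset.prod_ne_zero_iff.mpr fun p hp => (Finset.mem_filter.mp hp).2.1.ne_zero

theorem mem_of_dvd_primeProd {p n : ℕ} (hp : p.Prime) (h : p ∣ primeProd S n) : p ∈ S := by
  classical
  obtain ⟨l, hl, hpl⟩ := (hp.prime.dvd_finsetProd_iff _).mp h
  obtain ⟨-, hl, hlS⟩ := Finset.mem_filter.mp hl
  rwa [(Nat.prime_dvd_prime_iff_eq hp hl).mp hpl]

theorem isLiftable_integralAt (S : Set ℕ) : IsLiftable (integralAt S) (primeProd S) :=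
  fun _ _ hx => exists_eq_intCast_add_mul hx fun _ hp h => mem_of_dvd_primeProd hp h

theorem exists_unfold {s : ℕ → DiscreteRat} (hs : ∀ n, ∃ c : ℤ, s n = c + q n * s (n + 1))
    (n k : ℕ) : ∃ a b : ℤ, s n = a + b * s (n + k) := by
  induction k with
  | zero => exact ⟨0, 1, by simp⟩
  | succ k ih =>
    obtain ⟨a, b, hab⟩ := ih
    obtain ⟨c, hc⟩ := hs (n + k)
    exact ⟨a + b * c, b * q (n + k), by rw [hab, hc]; push_cast; ring_nf⟩

/-- From index `p` on, every `primeProd S` is divisible by `p`, so unfolding far enough collects any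
power of `p`. -/
theorem exists_unfold_pow {s : ℕ → DiscreteRat}
    (hs : ∀ n, ∃ c : ℤ, s n = c + primeProd S n * s (n + 1)) {p : ℕ} (hp : p.Prime) (hpS : p ∈ S)
    (n e : ℕ) : ∃ (N : ℕ) (a b : ℤ), s n = a + b * (p : DiscreteRat) ^ e * s N := by
  induction e with
  | zero => exact ⟨n, 0, 1, by simp⟩
  | succ e ih =>
    obtain ⟨N, a, b, hab⟩ := ih
    -- Advancing by `p` puts the index at `N + p ≥ p`, so that the next factor is a multiple of `p`.
    obtain ⟨a', b', hab'⟩ := exists_unfold hs N p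
    obtain ⟨c, hc⟩ := hs (N + p)
    obtain ⟨t, ht⟩ := dvd_primeProd hp hpS (Nat.le_add_left p N)
    refine ⟨N + p + 1, a + b * p ^ e * a' + b * p ^ e * b' * c, b * b' * t, ?_⟩
    rw [hab, hab', hc, ht]
    push_cast
    ring

/-- Termwise division by `m` keeps the digits integral; what must be checked is integrality of the
quotients at each `p` in `S`. If `p ^ e` is the exact power of `p` in `m`, unfolding writes `s n` as
`a + b * p ^ e * s N`, and `p ^ e * s N` is integral at `p` because `m * s N = r N` is. -/
theorem exists_eq_smul_of_dvd_digit {m : ℤ} (hm : m ≠ 0)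
    {r : tower (integralAt S) (primeProd S)}
    (h : ∀ n, m ∣ digit (integralAt S) (primeProd S) n r) :
    ∃ s : tower (integralAt S) (primeProd S), r = m • s := by
  have hm' : (m : DiscreteRat) ≠ 0 := by exact_mod_cast hm
  let s : ℕ → DiscreteRat := fun n => r.1 n / m
  have hs : ∀ n, ∃ c : ℤ, s n = c + primeProd S n * s (n + 1) := by
    intro n
    obtain ⟨c, hc⟩ := h n
    refine ⟨c, ?_⟩
    have := apply_eq_digit_add r n
    rw [hc] at this
    push_cast at this
    simp only [s]
    field_simp
    rw [this]
  have hR : ∀ n, s n ∈ integralAt S := by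
    intro n p hpS hp
    have hpp := Nat.prime_iff_prime_int.mp hp
    obtain ⟨m', hmm', hpm'⟩ :=
      (Int.finiteMultiplicity_iff.mpr ⟨by simpa using hp.one_lt.ne', hm⟩ :
        FiniteMultiplicity (p : ℤ) m).exists_eq_pow_mul_and_not_dvd
    obtain ⟨N, a, b, hab⟩ := exists_unfold_pow hs hp hpS n (multiplicity (p : ℤ) m)
    obtain ⟨d, c, hd, hc⟩ := (r.2 N).1 p hpS hp
    refine ⟨d * m', d * m' * a + b * c, fun h => (hpp.dvd_or_dvd h).elim hd hpm', ?_⟩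
    have e : (m : DiscreteRat) = (p : DiscreteRat) ^ multiplicity (p : ℤ) m * m' := by
      exact_mod_cast congrArg (Int.cast : ℤ → DiscreteRat) hmm'
    have e2 : (m : DiscreteRat) * s N = r.1 N := by simp only [s]; field_simp
    rw [hab]
    push_cast
    rw [← hc, ← e2]
    linear_combination - (b : DiscreteRat) * d * s N * e
  refine ⟨⟨s, fun n => ⟨hR n, hs n⟩⟩, Subtype.ext (funext fun n => ?_)⟩
  change r.1 n = m • s n
  rw [zsmul_eq_mul]
  simp only [s]
  field_simp

/-- Zero digits are divisible by every power of `p`, so every term is infinitely `p`-divisible in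
`integralAt S`. -/
theorem eq_zero_of_digit_eq_zero {p : ℕ} (hp : p.Prime) (hpS : p ∈ S)
    {r : tower (integralAt S) (primeProd S)}
    (h : ∀ n, digit (integralAt S) (primeProd S) n r = 0) : r = 0 := by
  refine Subtype.ext (funext fun n => eq_zero_of_forall_pow_mul hpS hp fun k => ?_)
  obtain ⟨s, hs⟩ := exists_eq_smul_of_dvd_digit (m := (p : ℤ) ^ k)
    (pow_ne_zero _ (by exact_mod_cast hp.ne_zero)) (r := r) fun n => by rw [h]; exact dvd_zero _
  refine ⟨s.1 n, (s.2 n).1, ?_⟩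
  have : r.1 n = ((p : ℤ) ^ k) • s.1 n := by rw [hs]; rfl
  rw [this, zsmul_eq_mul]
  push_cast
  rfl

theorem detectedByIntHoms_tower {p : ℕ} (hp : p.Prime) (hpS : p ∈ S) :
    DetectedByIntHoms (tower (integralAt S) (primeProd S)) where
  eq_zero _ h := eq_zero_of_digit_eq_zero hp hpS fun n => h (digit _ _ n)
  divisible _ _ hm h := exists_eq_smul_of_dvd_digit hm fun n => h (digit _ _ n)

end DiscreteRat

/-! ### Truncated towers: complete decomposability and the inverse limit -/

theorem isCompletelyDecomposable_of_rank_eq_one {A : Type} [AddCommGroup A]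
    (hA : IsAddTorsionFree A) (h : Module.rank ℤ A = 1) : IsCompletelyDecomposable A :=
  ⟨Unit, fun _ => A, fun _ => inferInstance, fun _ => ⟨hA, h⟩, ⟨(DirectSum.id A Unit).symm⟩⟩

theorem IsCompletelyDecomposable.of_addEquiv {A B : Type} [AddCommGroup A] [AddCommGroup B]
    (e : A ≃+ B) (h : IsCompletelyDecomposable A) : IsCompletelyDecomposable B := by
  obtain ⟨κ, C, hC, h1, ⟨f⟩⟩ := h
  exact ⟨κ, C, hC, h1, ⟨e.symm.trans f⟩⟩

/-- The family of types extending `C` by `ℤ` at `none`. -/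
def OptionIntFamily {κ : Type} (C : κ → Type) : Option κ → Type
  | none => ℤ
  | some k => C k

instance {κ : Type} (C : κ → Type) [∀ k, AddCommGroup (C k)] :
    ∀ o, AddCommGroup (OptionIntFamily C o)
  | none => inferInstanceAs (AddCommGroup ℤ)
  | some k => inferInstanceAs (AddCommGroup (C k))

theorem IsCompletelyDecomposable.int_prod {A : Type} [AddCommGroup A]
    (h : IsCompletelyDecomposable A) : IsCompletelyDecomposable (ℤ × A) := by
  obtain ⟨κ, C, hC, h1, ⟨f⟩⟩ := h
  refine ⟨Option κ, OptionIntFamily C, inferInstance, fun o => ?_, ⟨?_⟩⟩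
  · cases o with
    | none => exact ⟨inferInstanceAs (IsAddTorsionFree ℤ), CommSemiring.rank_self ℤ⟩
    | some k => exact h1 k
  · let e : ℤ ≃+ OptionIntFamily C none := AddEquiv.refl ℤ
    let g : DirectSum κ C ≃+ DirectSum κ fun k => OptionIntFamily C (some k) :=
      AddEquiv.refl (DirectSum κ C)
    exact (AddEquiv.prodCongr e (f.trans g)).trans
      (DirectSum.addEquivProdDirectSum (α := OptionIntFamily C)).symm

namespace DiscreteRat

variable {R : AddSubgroup DiscreteRat} {q : ℕ → ℕ}

instance : IsAddTorsionFree DiscreteRat := inferInstanceAs (IsAddTorsionFree ℚ)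

theorem rank_eq_one_of_one_mem (h : 1 ∈ R) : Module.rank ℤ R = 1 := by
  apply le_antisymm
  · have h1 : Module.rank ℤ R ≤ Module.rank ℤ DiscreteRat :=
      LinearMap.rank_le_of_injective R.subtype.toIntLinearMap Subtype.val_injective
    have h2 : Module.rank ℤ ℚ = 1 := by
      rw [← IsLocalization.rank_eq ℚ (nonZeroDivisors ℤ) le_rfl, CommSemiring.rank_self]
    exact h1.trans h2.le
  · rw [Cardinal.one_le_iff_pos, rank_pos_iff_exists_ne_zero]
    exact ⟨⟨1, h⟩, fun h0 => one_ne_zero (congrArg Subtype.val h0)⟩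

/-- The finite towers with terms in degrees `0, …, n`, extended by `0`. -/
def truncatedTower (R : AddSubgroup DiscreteRat) (q : ℕ → ℕ) (n : ℕ) :
    AddSubgroup (ℕ → DiscreteRat) where
  carrier := {r | (∀ i, r i ∈ R) ∧ (∀ i < n, ∃ c : ℤ, r i = c + q i * r (i + 1)) ∧
    ∀ i > n, r i = 0}
  zero_mem' := ⟨fun _ => zero_mem R, fun _ _ => ⟨0, by simp⟩, fun _ _ => rfl⟩
  add_mem' := by
    rintro r s ⟨hr, hr', hr''⟩ ⟨hs, hs', hs''⟩
    refine ⟨fun i => add_mem (hr i) (hs i), fun i hi => ?_, fun i hi => ?_⟩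
    · obtain ⟨c, hc⟩ := hr' i hi
      obtain ⟨d, hd⟩ := hs' i hi
      exact ⟨c + d, by simp only [Pi.add_apply]; rw [hc, hd]; push_cast; ring⟩
    · simp [hr'' i hi, hs'' i hi]
  neg_mem' := by
    rintro r ⟨hr, hr', hr''⟩
    refine ⟨fun i => neg_mem (hr i), fun i hi => ?_, fun i hi => ?_⟩
    · obtain ⟨c, hc⟩ := hr' i hi
      exact ⟨-c, by simp only [Pi.neg_apply]; rw [hc]; push_cast; ring⟩
    · simp [hr'' i hi]

theorem truncatedTower_ext {n : ℕ} {r s : truncatedTower R q n} (h : ∀ i ≤ n, r.1 i = s.1 i) :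
    r = s := by
  refine Subtype.ext (funext fun i => ?_)
  by_cases hi : i ≤ n
  · exact h i hi
  · rw [r.2.2.2 i (not_le.mp hi), s.2.2.2 i (not_le.mp hi)]

/-- The terms of a truncated tower. -/
def truncatedTowerTerms (R : AddSubgroup DiscreteRat) (q : ℕ → ℕ) (n : ℕ)
    (r : truncatedTower R q n) : Fin (n + 1) → DiscreteRat := fun i => r.1 i

theorem truncatedTowerTerms_injective (n : ℕ) :
    Function.Injective (truncatedTowerTerms R q n) := fun _ _ h =>
  truncatedTower_ext fun i hi => congrFun h ⟨i, Nat.lt_succ_of_le hi⟩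

instance (n : ℕ) : Countable (truncatedTower R q n) :=
  (truncatedTowerTerms_injective n).countable

instance (n : ℕ) : DiscreteTopology (truncatedTower R q n) :=
  DiscreteTopology.of_continuous_injective
    (continuous_pi fun _ => (continuous_apply _).comp continuous_subtype_val)
    (truncatedTowerTerms_injective n)

/-- Splitting off the first digit of a truncated tower. -/
theorem nonempty_int_prod_addEquiv (h1 : 1 ∈ R) (q : ℕ → ℕ) (n : ℕ) :
    Nonempty (ℤ × truncatedTower R (fun i => q (i + 1)) n ≃+ truncatedTower R q (n + 1)) := by
  have hint : ∀ c : ℤ, (c : DiscreteRat) ∈ R := fun c => by simpa using zsmul_mem h1 c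
  let F : ℤ × truncatedTower R (fun i => q (i + 1)) n → ℕ → DiscreteRat := fun p i =>
    Nat.casesOn i (p.1 + q 0 * p.2.1 0) p.2.1
  let f : ℤ × truncatedTower R (fun i => q (i + 1)) n →+ truncatedTower R q (n + 1) :=
    AddMonoidHom.mk' (fun p => ⟨F p, fun i : ℕ => by
        cases i with
        | zero => exact add_mem (hint _) (natCast_mul_mem (p.2.2.1 0) _)
        | succ i => exact p.2.2.1 i, fun i hi => by
        cases i with
        | zero => exact ⟨p.1, rfl⟩
        | succ i => exact p.2.2.2.1 i (Nat.lt_of_succ_lt_succ hi), fun i hi => by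
        cases i with
        | zero => exact absurd hi (Nat.not_lt_zero _)
        | succ i => exact p.2.2.2.2 i (Nat.lt_of_succ_lt_succ hi)⟩) (by
      rintro ⟨c, r⟩ ⟨d, s⟩
      refine Subtype.ext (funext fun i => ?_)
      cases i with
      | zero =>
        change ((c + d : ℤ) : DiscreteRat) + q 0 * (r.1 0 + s.1 0) =
          (c + q 0 * r.1 0) + (d + q 0 * s.1 0)
        push_cast
        ring
      | succ i => rfl)
  refine ⟨AddEquiv.ofBijective f ⟨?_, ?_⟩⟩
  · rintro ⟨c, r⟩ ⟨d, s⟩ h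
    have hrs : r = s := Subtype.ext (funext fun i => congrFun (congrArg Subtype.val h) (i + 1))
    subst hrs
    have h0 : (c : DiscreteRat) + q 0 * r.1 0 = d + q 0 * r.1 0 :=
      congrFun (congrArg Subtype.val h) 0
    have : c = d := by exact_mod_cast add_right_cancel h0
    rw [this]
  · intro r
    obtain ⟨c, hc⟩ := r.2.2.1 0 (Nat.succ_pos n)
    refine ⟨(c, ⟨fun i => r.1 (i + 1), fun i => r.2.1 _,
      fun i hi => r.2.2.1 (i + 1) (Nat.succ_lt_succ hi),
      fun i hi => r.2.2.2 (i + 1) (Nat.succ_lt_succ hi)⟩), Subtype.ext (funext fun i => ?_)⟩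
    cases i with
    | zero => exact hc.symm
    | succ i => rfl

/-- Splitting off the digits one at a time leaves `ℤ ^ n × R`, with `R` of rank one. Each splitting
shifts `q`, so the induction runs over all `q` at once. -/
theorem isCompletelyDecomposable_truncatedTower (h1 : 1 ∈ R) (q : ℕ → ℕ) (n : ℕ) :
    IsCompletelyDecomposable (truncatedTower R q n) := by
  induction n generalizing q with
  | zero =>
    let f : truncatedTower R q 0 →+ R :=
      AddMonoidHom.mk' (fun r => ⟨r.1 0, r.2.1 0⟩) fun _ _ => rfl
    have hf : Function.Bijective f := by
      refine ⟨fun r s h => truncatedTower_ext fun i hi => ?_, fun x => ?_⟩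
      · obtain rfl := Nat.le_zero.mp hi
        exact congrArg Subtype.val h
      · refine ⟨⟨Pi.single 0 x.1, fun i => ?_, fun i hi => absurd hi (Nat.not_lt_zero _),
          fun i hi => Pi.single_eq_of_ne hi.ne' _⟩, Subtype.ext ?_⟩
        rotate_left
        · exact Pi.single_eq_same (M := fun _ => DiscreteRat) 0 x.1
        by_cases hi : i = 0
        · rw [hi, Pi.single_eq_same]
          exact x.2
        · rw [Pi.single_eq_of_ne hi]
          exact zero_mem R
    exact (isCompletelyDecomposable_of_rank_eq_one inferInstance
      (rank_eq_one_of_one_mem h1)).of_addEquiv (AddEquiv.ofBijective f hf).symm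
  | succ n ih =>
    obtain ⟨e⟩ := nonempty_int_prod_addEquiv h1 q n
    exact (ih _).int_prod.of_addEquiv e

/-- Replacing the terms of degree more than `m` by `0`. -/
def truncate (m : ℕ) : (ℕ → DiscreteRat) →+ (ℕ → DiscreteRat) where
  toFun r i := if i ≤ m then r i else 0
  map_zero' := funext fun i => by simp
  map_add' r s := funext fun i => by
    by_cases hi : i ≤ m <;> simp [hi]

theorem truncate_apply_of_le {m i : ℕ} (hi : i ≤ m) (r : ℕ → DiscreteRat) :
    truncate m r i = r i := if_pos hi

theorem truncate_mem {m : ℕ} {r : ℕ → DiscreteRat} (hr : ∀ i ≤ m, r i ∈ R)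
    (hr' : ∀ i < m, ∃ c : ℤ, r i = c + q i * r (i + 1)) :
    truncate m r ∈ truncatedTower R q m := by
  refine ⟨fun i => ?_, fun i hi => ?_, fun i hi => if_neg (not_le.mpr hi)⟩
  · by_cases hi : i ≤ m
    · rw [truncate_apply_of_le hi]
      exact hr i hi
    · have : truncate m r i = 0 := if_neg hi
      rw [this]
      exact zero_mem R
  · rw [truncate_apply_of_le hi.le, truncate_apply_of_le (Nat.succ_le_of_lt hi)]
    exact hr' i hi

/-- The inverse sequence of truncated towers. -/
def truncatedTowerSequence (h : IsLiftable R q) :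
    InverseSequence (fun n => truncatedTower R q n) where
  map m n hmn := AddMonoidHom.mk' (fun r => ⟨truncate m r.1, truncate_mem (fun i _ => r.2.1 i)
    fun i hi => r.2.2.1 i (hi.trans_le hmn)⟩) fun r s => Subtype.ext (map_add (truncate m) _ _)
  map_self n x := truncatedTower_ext fun i hi => truncate_apply_of_le hi _
  map_map l m n hlm hmn x := truncatedTower_ext fun i hi =>
    (truncate_apply_of_le hi _).trans
      ((truncate_apply_of_le (hi.trans hlm) _).trans (truncate_apply_of_le hi _).symm)
  surjective m n hmn a := by
    obtain ⟨r, hr⟩ := h.exists_extension m a.1 (fun i _ => a.2.1 i) a.2.2.1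
    refine ⟨⟨truncate n r.1, truncate_mem (fun i _ => (r.2 i).1) fun i _ => (r.2 i).2⟩,
      truncatedTower_ext fun i hi => ?_⟩
    exact (truncate_apply_of_le hi _).trans
      ((truncate_apply_of_le (hi.trans hmn) _).trans (hr i hi))

theorem truncatedTowerSequence_limit_apply {h : IsLiftable R q}
    (a : (truncatedTowerSequence h).limit) {m n : ℕ} (hmn : m ≤ n) {i : ℕ} (hi : i ≤ m) :
    (a.1 n).1 i = (a.1 m).1 i := by
  rw [← a.2 m n hmn]
  exact (truncate_apply_of_le hi _).symm

/-- A group of towers is the inverse limit of its truncations. -/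
def towerEquivLimit (h : IsLiftable R q) : tower R q ≃ₜ+ (truncatedTowerSequence h).limit where
  toFun r := ⟨fun n => ⟨truncate n r.1, truncate_mem (fun i _ => (r.2 i).1) fun i _ => (r.2 i).2⟩,
    fun m n hmn => truncatedTower_ext fun i hi =>
      (truncate_apply_of_le hi _).trans ((truncate_apply_of_le (hi.trans hmn) _).trans
        (truncate_apply_of_le hi _).symm)⟩
  -- The diagonal suffices, since by coherence the `n`-th term is the same in every truncation from
  -- stage `n` on.
  invFun a := ⟨fun n => (a.1 n).1 n, fun n => ⟨(a.1 n).2.1 n, by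
    obtain ⟨c, hc⟩ := (a.1 (n + 1)).2.2.1 n (Nat.lt_succ_self n)
    exact ⟨c, (truncatedTowerSequence_limit_apply a (Nat.le_succ n) le_rfl).symm.trans hc⟩⟩⟩
  left_inv r := Subtype.ext (funext fun n => truncate_apply_of_le le_rfl _)
  right_inv a := Subtype.ext (funext fun n => truncatedTower_ext fun i hi =>
    (truncate_apply_of_le hi _).trans
      (truncatedTowerSequence_limit_apply a hi le_rfl).symm)
  map_add' r s := Subtype.ext (funext fun n => Subtype.ext (map_add (truncate n) _ _))
  continuous_toFun := by
    refine Continuous.subtype_mk (continuous_pi fun n => Continuous.subtype_mk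
      (continuous_pi fun i => ?_) _) _
    by_cases hi : i ≤ n
    · have : (fun r : tower R q => truncate n r.1 i) = fun r => r.1 i :=
        funext fun r => truncate_apply_of_le hi _
      rw [this]
      exact (continuous_apply i).comp continuous_subtype_val
    · have : (fun r : tower R q => truncate n r.1 i) = fun _ => 0 := funext fun r => if_neg hi
      rw [this]
      exact continuous_const
  continuous_invFun := by
    refine Continuous.subtype_mk (continuous_pi fun n => ?_) _
    exact (continuous_apply n).comp (continuous_subtype_val.comp
      ((continuous_apply n).comp continuous_subtype_val))

theorem isInverseLimitOfCompletelyDecomposable_tower (h : IsLiftable R q) (h1 : 1 ∈ R) :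
    IsInverseLimitOfCompletelyDecomposable (tower R q) :=
  ⟨fun n => truncatedTower R q n, fun _ => inferInstance, fun _ => inferInstance,
    fun _ => inferInstance, fun _ => inferInstance, truncatedTowerSequence h,
    fun n => ⟨inferInstance, isCompletelyDecomposable_truncatedTower h1 q n⟩,
    ⟨towerEquivLimit h⟩⟩

end DiscreteRat

/-! ### The topology of the tower groups -/

theorem exists_forall_eq_imp_mem_of_mem_nhds {X : ℕ → Type*} [∀ n, TopologicalSpace (X n)]
    [∀ n, DiscreteTopology (X n)] {x : ∀ n, X n} {U : Set (∀ n, X n)} (hU : U ∈ 𝓝 x) :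
    ∃ n, ∀ y : ∀ n, X n, (∀ i < n, y i = x i) → y ∈ U := by
  obtain ⟨_, ⟨z, n, rfl⟩, hx, hs⟩ := (PiNat.isTopologicalBasis_cylinders X).mem_nhds_iff.mp hU
  exact ⟨n, fun y hy => hs fun i hi => (hy i hi).trans (hx i hi)⟩

namespace DiscreteRat

variable {R : AddSubgroup DiscreteRat} {q : ℕ → ℕ}

instance : PolishSpace (ℕ → DiscreteRat) where
  toSecondCountableTopology := inferInstance
  toIsCompletelyMetrizableSpace := inferInstance

theorem continuous_tower_apply (i : ℕ) : Continuous fun r : tower R q => r.1 i :=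
  (continuous_apply i).comp continuous_subtype_val

theorem isClosed_tower (R : AddSubgroup DiscreteRat) (q : ℕ → ℕ) :
    IsClosed (tower R q : Set (ℕ → DiscreteRat)) := by
  have : (tower R q : Set (ℕ → DiscreteRat)) =
      ⋂ n, (fun r : ℕ → DiscreteRat => (r n, r (n + 1))) ⁻¹'
        {p | p.1 ∈ R ∧ ∃ c : ℤ, p.1 = c + q n * p.2} := by
    ext r
    simp [tower]
  rw [this]
  exact isClosed_iInter fun n => (isClosed_discrete _).preimage
    ((continuous_apply n).prodMk (continuous_apply (n + 1)))

/-- The towers whose terms of degree less than `n` vanish. -/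
def openSubgroup (R : AddSubgroup DiscreteRat) (q : ℕ → ℕ) (n : ℕ) :
    OpenAddSubgroup (tower R q) where
  carrier := {r | ∀ i < n, r.1 i = 0}
  zero_mem' := fun _ _ => rfl
  add_mem' := fun {r s} hr hs i hi => by
    change r.1 i + s.1 i = 0
    rw [hr i hi, hs i hi, add_zero]
  neg_mem' := fun {r} hr i hi => by
    change - r.1 i = 0
    rw [hr i hi, neg_zero]
  isOpen' := by
    have : {r : tower R q | ∀ i < n, r.1 i = 0} =
        ⋂ i ∈ Set.Iio n, (fun r : tower R q => r.1 i) ⁻¹' {0} := by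
      ext r
      simp
    change IsOpen {r : tower R q | ∀ i < n, r.1 i = 0}
    rw [this]
    exact (Set.finite_Iio n).isOpen_biInter fun i _ =>
      (isOpen_discrete _).preimage (continuous_tower_apply i)

theorem exists_openSubgroup_subset {U : Set (tower R q)} (hU : U ∈ 𝓝 0) :
    ∃ n, ∀ r : tower R q, (∀ i < n, r.1 i = 0) → r ∈ U := by
  obtain ⟨W, hW, hWU⟩ := mem_nhds_subtype _ _ _ |>.mp hU
  obtain ⟨n, hn⟩ := exists_forall_eq_imp_mem_of_mem_nhds hW
  exact ⟨n, fun r hr => hWU (hn r.1 hr)⟩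

theorem isNonArchimedeanPolish_tower (R : AddSubgroup DiscreteRat) (q : ℕ → ℕ) :
    IsNonArchimedeanPolish (tower R q) where
  isTopologicalAddGroup := inferInstance
  polishSpace := (isClosed_tower R q).polishSpace
  basis := ⟨openSubgroup R q, ⟨fun U => ⟨fun hU => by
      obtain ⟨n, hn⟩ := exists_openSubgroup_subset hU
      exact ⟨n, trivial, hn⟩, fun ⟨n, _, hn⟩ =>
    Filter.mem_of_superset ((openSubgroup R q n).mem_nhds_zero) hn⟩⟩⟩

/-! ### Excluding product decompositions and surjections -/

variable {S T : Set ℕ}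

theorem one_mem_integralAt (S : Set ℕ) : 1 ∈ integralAt S := by
  simpa using intCast_mem_integralAt S 1

/-- Projecting to finitely many factors of a product gives an endomorphism `θ` with open kernel, and
enough factors put that kernel inside `r 0 = 0`. A tower with zero digits below `m` and `m`-th term
`1` has infinitely `l`-divisible image, which is therefore `0`; yet its term in degree `0` is a
product of nonzero `primeProd S k`. -/
theorem not_isProductGroup_tower {p l : ℕ} (hp : p.Prime) (hpS : p ∈ S) (hl : l.Prime)
    (hlS : l ∉ S) : ¬ IsProductGroup (tower (integralAt S) (primeProd S)) := by
  rintro ⟨H, _, _, _, _, ⟨φ⟩⟩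
  let V : Set (tower (integralAt S) (primeProd S)) := {r | r.1 0 = 0}
  have hV : V ∈ 𝓝 0 := ((isOpen_discrete {0}).preimage (continuous_tower_apply 0)).mem_nhds rfl
  have hφV : φ.symm ⁻¹' V ∈ 𝓝 0 :=
    (map_continuous φ.symm).continuousAt.preimage_mem_nhds (by rwa [map_zero])
  obtain ⟨n, hn⟩ := exists_forall_eq_imp_mem_of_mem_nhds hφV
  let head : (∀ n, H n) →+ (∀ n, H n) :=
    { toFun := fun x i => if i < n then x i else 0
      map_zero' := funext fun i => by simp
      map_add' := fun x y => funext fun i => by by_cases hi : i < n <;> simp [hi] }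
  have hhead : ∀ x, ∀ i < n, head x i = x i := fun x i hi => if_pos hi
  let θ : tower (integralAt S) (primeProd S) →+ tower (integralAt S) (primeProd S) :=
    (φ.symm : (∀ n, H n) →+ _).comp (head.comp (φ : _ →+ ∀ n, H n))
  have hθ : ∀ r, θ r = φ.symm (head (φ r)) := fun _ => rfl
  have hθ0 : ∀ r, θ r = 0 → r.1 0 = 0 := by
    intro r hr
    rw [hθ, EmbeddingLike.map_eq_zero_iff] at hr
    have h1 : φ.symm (φ r) ∈ V := hn (φ r) fun i hi => by rw [← hhead (φ r) i hi, hr]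
    rwa [φ.symm_apply_apply] at h1
  have hker : {r | θ r = 0} ∈ 𝓝 (0 : tower (integralAt S) (primeProd S)) := by
    have hopen : IsOpen (⋂ i ∈ Set.Iio n, (fun x : ∀ n, H n => x i) ⁻¹' {0}) :=
      (Set.finite_Iio n).isOpen_biInter fun i _ =>
        (isOpen_discrete _).preimage (continuous_apply i)
    refine Filter.mem_of_superset ((hopen.preimage φ.continuous).mem_nhds ?_) fun r hr => ?_
    · simp
    · have h0 : head (φ r) = 0 := funext fun i => by
        by_cases hi : i < n
        · rw [hhead _ _ hi]
          exact Set.mem_iInter₂.mp hr i hi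
        · exact if_neg hi
      change θ r = 0
      rw [hθ, h0, map_zero]
  obtain ⟨m, hm⟩ := exists_openSubgroup_subset hker
  have hlift := isLiftable_integralAt S
  obtain ⟨u, hum, hu, hud⟩ := hlift.exists_digit_eq_zero m (one_mem_integralAt S)
  have hdiv := hlift.exists_eq_pow_smul hl.ne_zero
    (fun x hx k => div_pow_mem_integralAt hx hl hlS k) θ (m := m)
    (fun r hr => hm r fun i hi => hr i hi.le) hud
  have hθu : θ u = 0 := by
    refine eq_zero_of_digit_eq_zero hp hpS fun j => ?_
    by_contra hne
    -- Divisibility takes place inside the tower group, because `θ` is an endomorphism; hence it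
    -- passes to the integer digits.
    have hdvd : ∀ k : ℕ, (l : ℤ) ^ k ∣ digit (integralAt S) (primeProd S) j (θ u) := by
      intro k
      obtain ⟨w, hw⟩ := hdiv k
      rw [hw, map_nsmul, nsmul_eq_mul]
      push_cast
      exact dvd_mul_right _ _
    have h1 := Nat.le_of_dvd (Int.natAbs_pos.mpr hne)
      (Int.natAbs_dvd_natAbs.mpr (hdvd (digit (integralAt S) (primeProd S) j (θ u)).natAbs))
    rw [Int.natAbs_pow, Int.natAbs_natCast] at h1
    exact absurd (Nat.lt_pow_self hl.one_lt) (not_lt.mpr h1)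
  have h0 := hu 0 (Nat.zero_le m)
  rw [hθ0 u hθu, mul_one] at h0
  exact Finset.prod_ne_zero_iff.mpr (fun k _ => primeProd_ne_zero S k) (by exact_mod_cast h0.symm)

/-- The term of `f` in degree `0` has open kernel and lands in `integralAt T`, where `p` allows no
nonzero infinitely `p`-divisible element. Since `p` is invertible in `integralAt S`, this term
depends only on finitely many digits, so its image is finitely generated. Surjectivity would make
that image all of `integralAt T`, which contains every `1 / l ^ k`. -/
theorem not_surjective_of_prime {p l : ℕ} (hp : p.Prime) (hpT : p ∈ T) (hpS : p ∉ S)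
    (hl : l.Prime) (hlT : l ∉ T)
    (f : tower (integralAt S) (primeProd S) →ₜ+ tower (integralAt T) (primeProd T)) :
    ¬ Function.Surjective f := by
  intro hf
  let θ : tower (integralAt S) (primeProd S) →+ DiscreteRat :=
    (Pi.evalAddMonoidHom (fun _ => DiscreteRat) 0).comp
      ((tower (integralAt T) (primeProd T)).subtype.comp f.toAddMonoidHom)
  have hθ : ∀ r, θ r = (f r).1 0 := fun _ => rfl
  have hθT : ∀ r, θ r ∈ integralAt T := fun r => ((f r).2 0).1
  have hker : {r | θ r = 0} ∈ 𝓝 (0 : tower (integralAt S) (primeProd S)) := by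
    have hc : Continuous θ := (continuous_tower_apply 0).comp f.continuous_toFun
    exact ((isOpen_discrete {0}).preimage hc).mem_nhds (map_zero θ)
  obtain ⟨m, hm⟩ := exists_openSubgroup_subset hker
  have hlift := isLiftable_integralAt S
  have hzero : ∀ u : tower (integralAt S) (primeProd S),
      (∀ i < m, digit (integralAt S) (primeProd S) i u = 0) → θ u = 0 := by
    intro u hu
    refine eq_zero_of_forall_pow_mul hpT hp fun k => ?_
    obtain ⟨w, hw⟩ := hlift.exists_eq_pow_smul hp.ne_zero
      (fun x hx k => div_pow_mem_integralAt hx hp hpS k) θ (m := m)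
      (fun r hr => hm r fun i hi => hr i hi.le) hu k
    exact ⟨θ w, hθT w, by rw [hw, nsmul_eq_mul]; push_cast; rfl⟩
  choose e he using fun j : Fin m =>
    hlift.exists_digit_eq_single (one_mem_integralAt S) m j.2
  have hexp : ∀ r, θ r = ∑ j : Fin m, digit (integralAt S) (primeProd S) j r • θ (e j) := by
    intro r
    have h1 := hzero (r - ∑ j : Fin m, digit (integralAt S) (primeProd S) j r • e j) fun i hi => by
      rw [map_sub, map_sum, Finset.sum_eq_single ⟨i, hi⟩]
      · simp [he ⟨i, hi⟩ i hi]
      · intro j _ hj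
        have : i ≠ j := fun h => hj (Fin.ext h.symm)
        simp [he j i hi, this]
      · simp
    rw [map_sub, map_sum, sub_eq_zero] at h1
    simpa only [map_zsmul] using h1
  -- The product of the denominators of the finitely many generators clears the denominator of every
  -- value of `θ`.
  choose a b hb _ hab using fun j : Fin m => exists_coprime_fraction (θ (e j))
  have hbound : ∀ r, ∃ c : ℤ, ((∏ j, b j : ℤ) : DiscreteRat) * θ r = c := by
    intro r
    rw [hexp r]
    refine ⟨∑ j : Fin m, digit (integralAt S) (primeProd S) j r *
      ((∏ i ∈ Finset.univ.erase j, b i) * a j), ?_⟩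
    rw [Finset.mul_sum]
    push_cast
    refine Finset.sum_congr rfl fun j _ => ?_
    rw [← Finset.mul_prod_erase _ _ (Finset.mem_univ j), ← hab j, zsmul_eq_mul]
    ring
  have hB : (∏ j, b j) ≠ 0 := Finset.prod_ne_zero_iff.mpr fun j _ => hb j
  have hdvd : ∀ k : ℕ, (l : ℤ) ^ k ∣ ∏ j, b j := by
    intro k
    -- Every element of `integralAt T`, here `1 / l ^ k`, is the term in degree `0` of some tower.
    obtain ⟨s, hs, -, -⟩ := (isLiftable_integralAt T).exists_digit_eq_zero 0
      (div_pow_mem_integralAt (one_mem_integralAt T) hl hlT k)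
    obtain ⟨r, rfl⟩ := hf s
    obtain ⟨c, hc⟩ := hbound r
    rw [hθ, hs] at hc
    refine ⟨c, ?_⟩
    have hl' : (l : DiscreteRat) ≠ 0 := by exact_mod_cast hl.ne_zero
    field_simp at hc
    exact_mod_cast hc
  have h1 := Nat.le_of_dvd (Int.natAbs_pos.mpr hB)
    (Int.natAbs_dvd_natAbs.mpr (hdvd (∏ j, b j).natAbs))
  rw [Int.natAbs_pow, Int.natAbs_natCast] at h1
  exact absurd (Nat.lt_pow_self hl.one_lt) (not_lt.mpr h1)

/-! ### Continuum many incomparable sets of primes -/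

/-- An antichain of sets of primes indexed by the sets of natural numbers. -/
def primeSet (X : Set ℕ) : Set ℕ :=
  {p | ∃ n, (n ∈ X ∧ p = Nat.nth Nat.Prime (2 * n)) ∨ (n ∉ X ∧ p = Nat.nth Nat.Prime (2 * n + 1))}

theorem nth_prime_injective : Function.Injective (Nat.nth Nat.Prime) :=
  Nat.nth_injective Nat.infinite_setOfPred_prime

theorem nth_prime_even_mem_primeSet {X : Set ℕ} {n : ℕ} :
    Nat.nth Nat.Prime (2 * n) ∈ primeSet X ↔ n ∈ X := by
  constructor
  · rintro ⟨k, ⟨hk, h⟩ | ⟨-, h⟩⟩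
    · have := nth_prime_injective h
      obtain rfl : n = k := by omega
      exact hk
    · have := nth_prime_injective h
      omega
  · exact fun h => ⟨n, Or.inl ⟨h, rfl⟩⟩

theorem nth_prime_odd_mem_primeSet {X : Set ℕ} {n : ℕ} :
    Nat.nth Nat.Prime (2 * n + 1) ∈ primeSet X ↔ n ∉ X := by
  constructor
  · rintro ⟨k, ⟨-, h⟩ | ⟨hk, h⟩⟩
    · have := nth_prime_injective h
      omega
    · have := nth_prime_injective h
      obtain rfl : n = k := by omega
      exact hk
  · exact fun h => ⟨n, Or.inr ⟨h, rfl⟩⟩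

/-- From each pair of consecutive primes `primeSet` contains exactly one, so at an index where `X`
and `Y` differ the two sets make opposite choices. -/
theorem exists_prime_mem_primeSet_not_mem {X Y : Set ℕ} (h : X ≠ Y) :
    ∃ p, p.Prime ∧ p ∈ primeSet Y ∧ p ∉ primeSet X := by
  obtain ⟨n, hn⟩ : ∃ n, ¬ (n ∈ X ↔ n ∈ Y) := by
    by_contra! h'
    exact h (Set.ext h')
  by_cases hY : n ∈ Y
  · exact ⟨_, Nat.prime_nth_prime (2 * n), nth_prime_even_mem_primeSet.mpr hY,
      fun h => hn ⟨fun _ => hY, fun _ => nth_prime_even_mem_primeSet.mp h⟩⟩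
  · refine ⟨_, Nat.prime_nth_prime (2 * n + 1), nth_prime_odd_mem_primeSet.mpr hY, fun h => ?_⟩
    have := nth_prime_odd_mem_primeSet.mp h
    tauto

theorem exists_prime_mem_primeSet (X : Set ℕ) : ∃ p, p.Prime ∧ p ∈ primeSet X := by
  -- Comparison with the complement, which always differs from `X`.
  obtain ⟨p, hp, h, -⟩ := exists_prime_mem_primeSet_not_mem (X := Xᶜ) (Y := X) compl_ne_self
  exact ⟨p, hp, h⟩

theorem exists_prime_not_mem_primeSet (X : Set ℕ) : ∃ p, p.Prime ∧ p ∉ primeSet X := by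
  obtain ⟨p, hp, -, h⟩ := exists_prime_mem_primeSet_not_mem (X := X) (Y := Xᶜ) compl_ne_self.symm
  exact ⟨p, hp, h⟩

end DiscreteRat

open DiscreteRat in
theorem theorem1p1 :
    ∃ (ι : Type) (G : ι → Type) (_ : ∀ i, AddCommGroup (G i)) (_ : ∀ i, TopologicalSpace (G i)),
      #ι = 𝔠 ∧
      (∀ i, IsNonArchimedeanPolish (G i) ∧
        IsSeparableAbelian (G i) ∧
        IsTorsionlessAbelian (G i) ∧
        IsAlephOneFree (G i) ∧
        ¬ IsProductGroup (G i) ∧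
        IsInverseLimitOfCompletelyDecomposable (G i)) ∧
      (∀ i j, i ≠ j → ¬ ∃ f : G i →ₜ+ G j, Function.Surjective f) := by
  refine ⟨Set ℕ, fun X => tower (integralAt (primeSet X)) (primeProd (primeSet X)),
    fun _ => inferInstance, fun _ => inferInstance, mk_set_nat, fun X => ?_, ?_⟩
  · obtain ⟨p, hp, hpX⟩ := exists_prime_mem_primeSet X
    obtain ⟨l, hl, hlX⟩ := exists_prime_not_mem_primeSet X
    have hdet := detectedByIntHoms_tower hp hpX
    exact ⟨isNonArchimedeanPolish_tower _ _, hdet.isSeparableAbelian, hdet.isTorsionlessAbelian,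
      hdet.isAlephOneFree, not_isProductGroup_tower hp hpX hl hlX,
      isInverseLimitOfCompletelyDecomposable_tower (isLiftable_integralAt _)
        (one_mem_integralAt _)⟩
  · rintro X Y hXY ⟨f, hf⟩
    obtain ⟨p, hp, hpY, hpX⟩ := exists_prime_mem_primeSet_not_mem hXY
    obtain ⟨l, hl, hlY⟩ := exists_prime_not_mem_primeSet Y
    exact not_surjective_of_prime hp hpY hpX hl hlY f hf
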